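/- Let $M=(E,\mathcal C)$ be an oriented matroid, given by its signed circuits, on the finite ground set $E=S\cup T$ with $S=\{s_1,\dots,s_n\}$, $T=\{t_1,\dots,t_n\}$ disjoint. Let $\mathcal C^*$ be its set of cocircuits (the non-empty signed sets of inclusion-minimal support among those orthogonal to all circuits). Suppose that $M$ is a P-matroid, i.e. $S$ is a basis of $M$ and there is no circuit $X$ such that $X_{s_i}=-X_{t_i}$ for every pair $s_i,t_i$ contained in the support of $X$. Let $q\notin E$, and let $\sigma:\mathcal C^*\to\{-,0,+\}$ be a localization, i.e. the family of signed sets on $E\cup\{q\}$ $$\widehat{\mathcal C}^*=\{(Y,\sigma(Y)) : Y\in\mathcal C^*\}\cup\{(Y_1\circ Y_2,0) : Y_1,Y_2\in\mathcal C^*\text{ adjacent},\ \sigma(Y_1)=-\sigma(Y_2)\neq 0\}$$ is the set of cocircuits of an oriented matroid. Here $(Y,s)$ is the signed set that agrees with $Y$ on $E$ and has sign $s$ at $q$; $Y_1\circ Y_2$ has the sign of $Y_1$ where this is non-zero and the sign of $Y_2$ elsewhere; and two cocircuits are adjacent if they are distinct, no element has opposite non-zero signs in them, and $Y_1\circ Y_2$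 has rank $2$ in the face lattice of covectors of $M$. Let $\widehat M$ be the oriented matroid on $E\cup\{q\}$ with set of cocircuits $\widehat{\mathcal C}^*$, the extension of $M$ specified by $\sigma$. Let $B$ be a complementary basis of $M$, i.e. a basis containing no pair $s_i,t_i$. Then $B$ is also a basis of $\widehat M$; there is a unique circuit $C(B,q)$ of $\widehat M$ that has sign $+$ at $q$ and support contained in $B\cup\{q\}$; for every $e\in B$ there is a unique cocircuit $C^*(B,e)$ of $M$ that has sign $+$ at $e$ and support disjoint from $B\setminus\{e\}$; and for every $e\in B$ $$C(B,q)_e=-\sigma\bigl(C^*(B,e)\bigr).$$ -/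

import Mathlib

/-- The positive part `X⁺` of a signed set, written as a sign vector. -/
def posPartSet {E : Type*} (X : E → SignType) : Set E := {e | X e = 1}

/-- The negative part `X⁻` of a signed set. -/
def negPartSet {E : Type*} (X : E → SignType) : Set E := {e | X e = -1}

/-- The support `X⁺ ∪ X⁻` of a signed set. -/
def signSupport {E : Type*} (X : E → SignType) : Set E := posPartSet X ∪ negPartSet X

/-- Two signed sets are orthogonal if their supports are disjoint, or if there are elements
`e, f` in both supports with `X e * Y e = -(X f * Y f)`. -/
def SignOrthogonal {E : Type*} (X Y : E → SignType) : Prop :=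
  signSupport X ∩ signSupport Y = ∅ ∨
    ∃ e ∈ signSupport X ∩ signSupport Y, ∃ f ∈ signSupport X ∩ signSupport Y,
      X e * Y e = -(X f * Y f)

/-- The composition `X ∘ Y`: the sign of `X` where it is non-zero, the sign of `Y` elsewhere. -/
def signComp {E : Type*} (X Y : E → SignType) : E → SignType :=
  fun e => if X e = 0 then Y e else X e

/-- The face order on sign vectors: `X` is obtained from `Y` by replacing some entries by `0`. -/
def SignFaceLE {E : Type*} (X Y : E → SignType) : Prop := ∀ e, X e = 0 ∨ X e = Y e

/-- The strict face order on sign vectors. -/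
def SignFaceLT {E : Type*} (X Y : E → SignType) : Prop := SignFaceLE X Y ∧ X ≠ Y

/-- An oriented matroid in circuit representation. The ground set is the whole (finite) type `E`. -/
structure OrientedMatroid (E : Type*) [Finite E] where
  /-- the collection of signed circuits -/
  circuits : Set (E → SignType)
  zero_notMem : (0 : E → SignType) ∉ circuits
  neg_mem_iff : ∀ X, X ∈ circuits ↔ -X ∈ circuits
  incomparable : ∀ X ∈ circuits, ∀ Y ∈ circuits,
    signSupport X ⊆ signSupport Y → X = Y ∨ X = -Y
  elimination : ∀ X ∈ circuits, ∀ Y ∈ circuits, X ≠ -Y →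
    ∀ e ∈ posPartSet X ∩ negPartSet Y, ∃ Z ∈ circuits,
      posPartSet Z ⊆ (posPartSet X ∪ posPartSet Y) \ {e} ∧
      negPartSet Z ⊆ (negPartSet X ∪ negPartSet Y) \ {e}

namespace OrientedMatroid

variable {E : Type*} [Finite E]

/-- A basis: an inclusion-maximal subset of the ground set containing no circuit. -/
def IsBasis (M : OrientedMatroid E) (B : Set E) : Prop :=
  Maximal (fun I : Set E => ∀ X ∈ M.circuits, ¬ signSupport X ⊆ I) B

/-- A covector: a sign vector orthogonal to all circuits. -/
def IsCovector (M : OrientedMatroid E) (Y : E → SignType) : Prop :=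
  ∀ X ∈ M.circuits, SignOrthogonal X Y

/-- The cocircuits: the non-empty signed sets orthogonal to all circuits whose support is
inclusion-minimal. -/
def cocircuits (M : OrientedMatroid E) : Set (E → SignType) :=
  {Y | M.IsCovector Y ∧ Y ≠ 0 ∧
    ∀ Z, M.IsCovector Z → Z ≠ 0 → signSupport Z ⊆ signSupport Y → signSupport Z = signSupport Y}

/-- `X` is the fundamental circuit `C(B, e)` (for a basis `B` and `e ∉ B`). -/
def IsFundamentalCircuit (M : OrientedMatroid E) (B : Set E) (e : E) (X : E → SignType) : Prop :=
  X ∈ M.circuits ∧ X e = 1 ∧ signSupport X ⊆ B ∪ {e}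

/-- `D` is the fundamental cocircuit `C*(B, e)` (for a basis `B` and `e ∈ B`). -/
def IsFundamentalCocircuit (M : OrientedMatroid E) (B : Set E) (e : E) (D : E → SignType) : Prop :=
  D ∈ M.cocircuits ∧ D e = 1 ∧ signSupport D ∩ (B \ {e}) = ∅

/-- Two cocircuits are adjacent if they are distinct, no element has opposite non-zero signs in
them, and their composition is of rank two in the face lattice of covectors, so that they are the
two end vertices of an edge. The rank is at least two since `0 < Y₁ < Y₁ ∘ Y₂`, so rank two means
that there is no chain `0 < X < X' < Y₁ ∘ Y₂` of covectors. -/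
def Adjacent (M : OrientedMatroid E) (Y₁ Y₂ : E → SignType) : Prop :=
  Y₁ ∈ M.cocircuits ∧ Y₂ ∈ M.cocircuits ∧ Y₁ ≠ Y₂ ∧
    (∀ e, Y₁ e ≠ 0 → Y₂ e ≠ 0 → Y₁ e = Y₂ e) ∧
    ¬ ∃ X X', M.IsCovector X ∧ M.IsCovector X' ∧
      X ≠ 0 ∧ SignFaceLT X X' ∧ SignFaceLT X' (signComp Y₁ Y₂)

/-- The signed set `(Y, s)` on `E ∪ {q}`. The new element `q` is `none : Option E`. -/
def extendSign (Y : E → SignType) (s : SignType) : Option E → SignType :=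
  fun o => o.elim s Y

/-- The family of signed sets on `E ∪ {q}` that a function `σ` on the cocircuits defines. -/
def extensionCocircuits (M : OrientedMatroid E) (σ : M.cocircuits → SignType) :
    Set (Option E → SignType) :=
  {W | ∃ Y : M.cocircuits, W = extendSign Y.1 (σ Y)} ∪
  {W | ∃ Y₁ Y₂ : M.cocircuits, M.Adjacent Y₁.1 Y₂.1 ∧ σ Y₁ = -σ Y₂ ∧ σ Y₁ ≠ 0 ∧
    W = extendSign (signComp Y₁.1 Y₂.1) 0}

/-- `Mhat` is the extension of `M` specified by `σ`. -/
def IsExtensionSpecifiedBy (M : OrientedMatroid E) (σ : M.cocircuits → SignType)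
    (Mhat : OrientedMatroid (Option E)) : Prop :=
  Mhat.cocircuits = M.extensionCocircuits σ

/-- `σ` is a localization: the family it defines is the set of cocircuits of an oriented matroid
on `E ∪ {q}`. -/
def IsLocalization (M : OrientedMatroid E) (σ : M.cocircuits → SignType) : Prop :=
  ∃ Mhat : OrientedMatroid (Option E), M.IsExtensionSpecifiedBy σ Mhat

/-- A set in `E_{2n} = S ∪ T` is complementary if it contains no pair `s_i, t_i`.
Here `s_i = Sum.inl i` and `t_i = Sum.inr i`. -/
def IsComplementary {n : ℕ} (J : Set (Fin n ⊕ Fin n)) : Prop :=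
  ∀ i : Fin n, ¬ (Sum.inl i ∈ J ∧ Sum.inr i ∈ J)

/-- A signed set is sign-reversing if `X_{s_i} = -X_{t_i}` for every complementary pair contained
in its support. -/
def IsSignReversing {n : ℕ} (X : Fin n ⊕ Fin n → SignType) : Prop :=
  ∀ i : Fin n, Sum.inl i ∈ signSupport X → Sum.inr i ∈ signSupport X →
    X (Sum.inl i) = -X (Sum.inr i)

/-- A P-matroid: `S` is a basis, and no circuit is sign-reversing. -/
def IsPMatroid {n : ℕ} (M : OrientedMatroid (Fin n ⊕ Fin n)) : Prop :=
  M.IsBasis (Set.range Sum.inl) ∧ ∀ X ∈ M.circuits, ¬ IsSignReversing X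

end OrientedMatroid

/-! The sign formula is a single orthogonality. Write `D` for the fundamental cocircuit of `e` and
`C` for the fundamental circuit of `q`. By construction `(D, σ D)` is a cocircuit of the extension,
hence orthogonal to `C`, and the supports can meet only in `e` and `q`. Both `D e` and `C q` are
`+`, so the two products being opposite reads `C e = -σ D` (`fundamentalCircuit_apply`).

That `B` remains a basis also comes from cocircuits. A circuit inside `B` would meet some `(D, σ D)`
in exactly one element, contradicting orthogonality. If a larger set were independent, a fundamental
cocircuit of the extension would vanish on `B`. Each cocircuit of the extension is built on a
cocircuit of `M`, and no non-zero covector of `M` vanishes on a basis.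

The substance is the existence of fundamental cocircuits, since only circuit axioms are given and
cocircuits are defined by orthogonality to all circuits. Orthogonality to the circuits `C(B, f)`
forces `D f = -C(B, f) e` off `B`. That this `D` is orthogonal to every circuit is
`isCovector_of_orthogonal_fundamental`, by induction on the size of `B`: elements of `B` other than
`e` are contracted until `B = {e}`, where one elimination suffices. Orthogonality lifts back from
the contraction by `b` because each circuit of `M` is covered, off `b`, by conformal circuits of the
contraction (`exists_contractionCircuit_conformal`). -/

/-! ### Sign vectors and orthogonality. -/

theorem mem_signSupport {E : Type*} {X : E → SignType} {a : E} :
    a ∈ signSupport X ↔ X a ≠ 0 := by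
  simp only [signSupport, posPartSet, negPartSet, Set.mem_union, Set.mem_ofPred_eq]
  cases X a <;> decide

theorem signSupport_subset_iff {E : Type*} {X Y : E → SignType} :
    signSupport X ⊆ signSupport Y ↔ ∀ a, Y a = 0 → X a = 0 := by
  simp only [Set.subset_def, mem_signSupport]
  exact forall_congr' fun a => not_imp_not

theorem signType_eq_or_eq_neg {s t : SignType} (hs : s ≠ 0) (ht : t ≠ 0) : s = t ∨ s = -t := by
  revert s t; decide

theorem signOrthogonal_iff {E : Type*} {X Y : E → SignType} :
    SignOrthogonal X Y ↔
      (∀ a, X a * Y a = 0) ∨ ∃ a b, X a * Y a ≠ 0 ∧ X a * Y a = -(X b * Y b) := by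
  have h1 : ∀ s t : SignType, s * t ≠ 0 ↔ s ≠ 0 ∧ t ≠ 0 := by decide
  have h2 : ∀ s : SignType, -s ≠ 0 ↔ s ≠ 0 := by decide
  unfold SignOrthogonal
  refine or_congr ?_ ⟨?_, ?_⟩
  · simp only [Set.eq_empty_iff_forall_notMem, Set.mem_inter_iff, mem_signSupport, ← h1, not_not]
  · rintro ⟨a, ha, b, hb, h⟩
    simp only [Set.mem_inter_iff, mem_signSupport, ← h1] at ha hb
    exact ⟨a, b, ha, h⟩
  · rintro ⟨a, b, ha, h⟩
    refine ⟨a, ?_, b, ?_, h⟩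
    · simpa only [Set.mem_inter_iff, mem_signSupport, ← h1] using ha
    · rw [h, h2] at ha
      simpa only [Set.mem_inter_iff, mem_signSupport, ← h1] using ha

/-- Orthogonality to a sign vector passes from conformal parts of `X` to `X`. -/
theorem signOrthogonal_of_conformal_cover {E : Type*} {X D : E → SignType}
    (h : ∀ g, X g ≠ 0 → D g ≠ 0 → ∃ V, SignOrthogonal V D ∧ V g ≠ 0 ∧ SignFaceLE V X) :
    SignOrthogonal X D := by
  have h1 : ∀ s t : SignType, s * t ≠ 0 ↔ s ≠ 0 ∧ t ≠ 0 := by decide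
  have h2 : ∀ s : SignType, -s ≠ 0 ↔ s ≠ 0 := by decide
  rw [signOrthogonal_iff]
  -- Non-orthogonality means that some product is non-zero and no two non-zero products are
  -- opposite; a conformal part through `g` inherits this.
  by_contra! hc
  obtain ⟨⟨g, hg⟩, hX⟩ := hc
  obtain ⟨V, hV, hVg, hVX⟩ := h g ((h1 _ _).1 hg).1 ((h1 _ _).1 hg).2
  rcases signOrthogonal_iff.1 hV with hV | ⟨a, b, ha, hab⟩
  · exact (h1 _ _).2 ⟨hVg, ((h1 _ _).1 hg).2⟩ (hV g)
  · have hb : V b * D b ≠ 0 := by rw [hab, h2] at ha; exact ha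
    have ea := (hVX a).resolve_left ((h1 _ _).1 ha).1
    have eb := (hVX b).resolve_left ((h1 _ _).1 hb).1
    rw [ea] at ha
    rw [ea, eb] at hab
    exact hX a b ha hab

/-- If the supports of orthogonal `X` and `Y` meet at most in `a` and `b`, the two products are
opposite. -/
theorem SignOrthogonal.mul_eq_neg_mul {E : Type*} {X Y : E → SignType} (h : SignOrthogonal X Y)
    {a b : E} (hab : a ≠ b) (h0 : ∀ c, c ≠ a → c ≠ b → X c = 0 ∨ Y c = 0) :
    X a * Y a = -(X b * Y b) := by
  have h1 : ∀ s t : SignType, s = 0 ∨ t = 0 → s * t = 0 := by decide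
  have h2 : ∀ s : SignType, s = -s → s = 0 := by decide
  have h3 : ∀ s t : SignType, s = -t → t = -s := by decide
  have hm : ∀ c, X c * Y c ≠ 0 → c = a ∨ c = b := by
    intro c hc
    by_contra! hne
    exact hc (h1 _ _ (h0 c hne.1 hne.2))
  rcases signOrthogonal_iff.1 h with h | ⟨c, d, hc, hcd⟩
  · rw [h a, h b]; rfl
  · have hd : X d * Y d ≠ 0 := by
      intro hd
      rw [hd] at hcd
      exact hc hcd
    rcases hm c hc with rfl | rfl <;> rcases hm d hd with rfl | rfl
    · exact absurd (h2 _ hcd) hc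
    · exact hcd
    · exact h3 _ _ hcd
    · exact absurd (h2 _ hcd) hc

theorem SignOrthogonal.neg_left {E : Type*} {X Y : E → SignType} (h : SignOrthogonal X Y) :
    SignOrthogonal (-X) Y := by
  have h1 : ∀ s t : SignType, s * t = 0 → -s * t = 0 := by decide
  have h2 : ∀ s t : SignType, s * t ≠ 0 → -s * t ≠ 0 := by decide
  have h3 : ∀ s t u v : SignType, s * t = -(u * v) → -s * t = -(-u * v) := by decide
  rw [signOrthogonal_iff] at h ⊢
  rcases h with h | ⟨a, b, ha, h⟩
  · exact Or.inl fun a => h1 _ _ (h a)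
  · exact Or.inr ⟨a, b, h2 _ _ ha, h3 _ _ _ _ h⟩

theorem SignOrthogonal.of_eq_mul {E : Type*} {X X' Y : E → SignType} (h : SignOrthogonal X Y)
    (hX : ∀ a, X a * Y a = X' a * Y a) : SignOrthogonal X' Y := by
  rw [signOrthogonal_iff] at h ⊢
  simpa only [hX] using h

namespace OrientedMatroid

variable {E : Type*} [Finite E]

theorem neg_mem (M : OrientedMatroid E) {X : E → SignType} (hX : X ∈ M.circuits) :
    -X ∈ M.circuits := (M.neg_mem_iff X).1 hX

theorem ne_zero (M : OrientedMatroid E) {X : E → SignType} (hX : X ∈ M.circuits) : X ≠ 0 :=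
  fun h => M.zero_notMem (h ▸ hX)

theorem eq_or_eq_neg (M : OrientedMatroid E) {X Y : E → SignType} (hX : X ∈ M.circuits)
    (hY : Y ∈ M.circuits) (h : ∀ a, Y a = 0 → X a = 0) : X = Y ∨ X = -Y :=
  M.incomparable X hX Y hY (signSupport_subset_iff.2 h)

/-- Elimination at an element with opposite signs. -/
theorem exists_eliminate (M : OrientedMatroid E) {X Y : E → SignType} (hX : X ∈ M.circuits)
    (hY : Y ∈ M.circuits) (hne : X ≠ -Y) {g : E} (hg : X g ≠ 0) (hXY : X g = -Y g) :
    ∃ Z ∈ M.circuits, Z g = 0 ∧ ∀ a, Z a = 0 ∨ Z a = X a ∨ Z a = Y a := by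
  have key : ∀ {X Y : E → SignType}, X ∈ M.circuits → Y ∈ M.circuits → X ≠ -Y → X g = 1 →
      Y g = -1 → ∃ Z ∈ M.circuits, Z g = 0 ∧ ∀ a, Z a = 0 ∨ Z a = X a ∨ Z a = Y a := by
    intro X Y hX hY hne h1 h2
    obtain ⟨Z, hZ, hp, hn⟩ := M.elimination X hX Y hY hne g ⟨h1, h2⟩
    have hz : ∀ a, Z a = 0 ∨ (a ≠ g ∧ (Z a = X a ∨ Z a = Y a)) := by
      intro a
      rcases hs : Z a with _ | _ | _
      · exact Or.inl rfl
      · obtain ⟨h, h'⟩ := hn (show a ∈ negPartSet Z from hs)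
        exact Or.inr ⟨h', h.imp (fun h => h.symm) (fun h => h.symm)⟩
      · obtain ⟨h, h'⟩ := hp (show a ∈ posPartSet Z from hs)
        exact Or.inr ⟨h', h.imp (fun h => h.symm) (fun h => h.symm)⟩
    exact ⟨Z, hZ, (hz g).resolve_right fun h => h.1 rfl, fun a => (hz a).imp_right And.right⟩
  rcases hs : X g with _ | _ | _
  · exact absurd hs hg
  · obtain ⟨Z, hZ, h0, h⟩ := key hY hX (fun h => hne (by rw [h, neg_neg]))
      (by rw [hs] at hXY; revert hXY; cases Y g <;> decide) hs
    exact ⟨Z, hZ, h0, fun a => (h a).imp_right Or.symm⟩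
  · exact key hX hY hne hs (by rw [hs] at hXY; revert hXY; cases Y g <;> decide)

theorem exists_apply_ne_zero (M : OrientedMatroid E) {X : E → SignType} (hX : X ∈ M.circuits) :
    ∃ a, X a ≠ 0 := Function.ne_iff.1 (M.ne_zero hX)

/-! ### Contraction: conformal covers of circuits. -/

section Contraction

open Classical in
/-- The sign vectors whose support-minimal members are the circuits of the contraction by `b`,
where `b` is kept as a loop. -/
def contractionFamily (M : OrientedMatroid E) (b : E) : Set (E → SignType) :=
  {V | V ≠ 0 ∧ ((∃ X ∈ M.circuits, V = Function.update X b 0) ∨ ∀ a, a ≠ b → V a = 0)}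

/-- The circuits of the contraction by `b`, where `b` is kept as a loop. -/
def contractionCircuits (M : OrientedMatroid E) (b : E) : Set (E → SignType) :=
  {W | W ∈ M.contractionFamily b ∧
    ∀ V ∈ M.contractionFamily b, (∀ a, W a = 0 → V a = 0) → ∀ a, V a = 0 → W a = 0}

/-- `b` is not a loop: every circuit has an element different from `b`. -/
def IsNonloop (M : OrientedMatroid E) (b : E) : Prop :=
  ∀ X ∈ M.circuits, ∃ a, a ≠ b ∧ X a ≠ 0

variable {M : OrientedMatroid E} {b : E}

open Classical in
theorem update_mem_contractionFamily (hb : M.IsNonloop b) {X : E → SignType}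
    (hX : X ∈ M.circuits) : Function.update X b 0 ∈ M.contractionFamily b := by
  obtain ⟨a, hab, ha⟩ := hb X hX
  refine ⟨fun h => ha ?_, Or.inl ⟨X, hX, rfl⟩⟩
  have := congrFun h a
  rwa [Function.update_of_ne hab] at this

open Classical in
theorem update_mem_contractionCircuits (hb : M.IsNonloop b) {X : E → SignType}
    (hX : X ∈ M.circuits) (hXb : X b ≠ 0) : Function.update X b 0 ∈ M.contractionCircuits b := by
  refine ⟨update_mem_contractionFamily hb hX, ?_⟩
  rintro V ⟨hV0, ⟨Y, hY, rfl⟩ | hV⟩ hVX a ha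
  · by_cases hab : a = b
    · rw [hab, Function.update_self]
    · rw [Function.update_of_ne hab] at ha ⊢
      have hYX : ∀ c, X c = 0 → Y c = 0 := by
        intro c hc
        have hcb : c ≠ b := by rintro rfl; exact hXb hc
        have := hVX c (by rwa [Function.update_of_ne hcb])
        rwa [Function.update_of_ne hcb] at this
      rcases M.eq_or_eq_neg hY hX hYX with rfl | rfl
      · exact ha
      · rw [Pi.neg_apply] at ha
        revert ha; cases X a <;> decide
  · refine absurd (funext fun c => ?_) hV0
    by_cases hcb : c = b
    · rw [hcb]
      exact hVX b (Function.update_self ..)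
    · exact hV c hcb

/-- Let `X` be a circuit avoiding `b`. If some circuit through `b` in `X ∪ b` has a property `P`
that is preserved by eliminating disagreements with `X`, then such a circuit can be chosen
conformal to `X` off `b`. -/
theorem exists_conformal_through {X : E → SignType} (hX : X ∈ M.circuits)
    (hXb : X b = 0) (P : (E → SignType) → Prop)
    (hne : ∃ Y ∈ M.circuits, P Y ∧ Y b ≠ 0 ∧ (∀ a, a ≠ b → X a = 0 → Y a = 0))
    (hP : ∀ Y ∈ M.circuits, P Y → Y b ≠ 0 → (∀ a, a ≠ b → X a = 0 → Y a = 0) →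
      ∀ k, X k ≠ 0 → Y k = -X k → ∀ Z ∈ M.circuits, Z b ≠ 0 → Z k = 0 →
        (∀ a, Z a = 0 ∨ Z a = X a ∨ Z a = Y a) → P Z) :
    ∃ W ∈ M.circuits, P W ∧ W b ≠ 0 ∧ (∀ a, a ≠ b → W a = 0 ∨ W a = X a) := by
  have h2 : ∀ s : SignType, s = -s → s = 0 := by decide
  have h3 : ∀ s t : SignType, s = -t → t = -s := by decide
  have h0 : ∀ s : SignType, -s = 0 → s = 0 := by decide
  -- Minimising the number of disagreements with `X` works because eliminating one creates no new
  -- one.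
  let dis : (E → SignType) → ℕ := fun Y => {k | X k ≠ 0 ∧ Y k = -X k}.ncard
  obtain ⟨Y, ⟨hY, hPY, hYb, hYX⟩, hmin⟩ := exists_minimalFor_of_wellFoundedLT
    (fun Y => Y ∈ M.circuits ∧ P Y ∧ Y b ≠ 0 ∧ (∀ a, a ≠ b → X a = 0 → Y a = 0)) dis hne
  refine ⟨Y, hY, hPY, hYb, fun a hab => ?_⟩
  by_contra! hc
  have hXa : X a ≠ 0 := fun h => hc.1 (hYX a hab h)
  have hYa : Y a = -X a := (signType_eq_or_eq_neg hc.1 hXa).resolve_left hc.2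
  have hXY : X ≠ -Y := by
    rintro rfl
    rw [Pi.neg_apply] at hXb
    revert hXb hYb; cases Y b <;> decide
  obtain ⟨Z, hZ, hZa, hZXY⟩ := M.exists_eliminate hX hY hXY hXa (h3 _ _ hYa)
  have hZX : ∀ c, c ≠ b → X c = 0 → Z c = 0 := by
    intro c hcb hcX
    rcases hZXY c with h | h | h
    · exact h
    · rw [h, hcX]
    · rw [h, hYX c hcb hcX]
  -- Otherwise `Z` would be a circuit inside `X` that misses `a`.
  have hZb : Z b ≠ 0 := by
    intro hZb
    have : ∀ c, X c = 0 → Z c = 0 := by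
      intro c hcX
      by_cases hcb : c = b
      · rw [hcb, hZb]
      · exact hZX c hcb hcX
    rcases M.eq_or_eq_neg hZ hX this with rfl | rfl
    · exact hXa hZa
    · rw [Pi.neg_apply] at hZa
      revert hZa hXa; cases X a <;> decide
  have hle := hmin ⟨hZ, hP Y hY hPY hYb hYX a hXa hYa Z hZ hZb hZa hZXY, hZb, hZX⟩
  have hlt : dis Z < dis Y := by
    refine Set.ncard_lt_ncard ⟨?_, fun hsub => ?_⟩ (Set.toFinite _)
    · rintro k ⟨hk, hZk⟩
      refine ⟨hk, ?_⟩
      rcases hZXY k with h | h | h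
      · rw [h] at hZk
        exact absurd (h0 _ hZk.symm) hk
      · rw [h] at hZk
        exact absurd (h2 _ hZk) hk
      · rw [← h, hZk]
    · have := (hsub ⟨hXa, hYa⟩).2
      rw [hZa] at this
      exact hXa (h0 _ this.symm)
  exact absurd (hle hlt.le) (not_le.2 hlt)

open Classical in
/-- Every element of a circuit other than `b` lies in a circuit of the contraction by `b` that is
conformal to the given one. -/
theorem exists_contractionCircuit_conformal (hb : M.IsNonloop b) {X : E → SignType}
    (hX : X ∈ M.circuits) {g : E} (hgb : g ≠ b) (hg : X g ≠ 0) :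
    ∃ V ∈ M.contractionCircuits b, V g ≠ 0 ∧ SignFaceLE V X := by
  have h0 : ∀ s : SignType, -s = 0 → s = 0 := by decide
  have h2 : ∀ s : SignType, s = -s → s = 0 := by decide
  have hdone : ∀ W ∈ M.circuits, W b ≠ 0 → W g ≠ 0 → (∀ a, a ≠ b → W a = 0 ∨ W a = X a) →
      ∃ V ∈ M.contractionCircuits b, V g ≠ 0 ∧ SignFaceLE V X := by
    intro W hW hWb hWg hWX
    refine ⟨_, update_mem_contractionCircuits hb hW hWb, ?_, fun a => ?_⟩
    · rwa [Function.update_of_ne hgb]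
    · by_cases hab : a = b
      · rw [hab, Function.update_self]
        exact Or.inl rfl
      · rw [Function.update_of_ne hab]
        exact hWX a hab
  by_cases hXb : X b = 0
  swap
  · exact hdone X hX hXb hg fun a _ => Or.inr rfl
  have hupd : Function.update X b 0 = X := by rw [← hXb, Function.update_eq_self]
  by_cases hXc : X ∈ M.contractionCircuits b
  · exact ⟨X, hXc, hg, fun a => Or.inr rfl⟩
  have hXf : X ∈ M.contractionFamily b := by
    have := update_mem_contractionFamily hb hX
    rwa [hupd] at this
  have hex : ∃ Y ∈ M.circuits, Y b ≠ 0 ∧ (∀ a, a ≠ b → X a = 0 → Y a = 0) := by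
    have : ∃ V ∈ M.contractionFamily b, (∀ a, X a = 0 → V a = 0) ∧ ∃ a, V a = 0 ∧ X a ≠ 0 := by
      by_contra! h
      exact hXc ⟨hXf, h⟩
    obtain ⟨V, ⟨hV0, ⟨Y, hY, rfl⟩ | hV⟩, hVX, a, hVa, hXa⟩ := this
    · have hab : a ≠ b := by rintro rfl; exact hXa hXb
      have hYX : ∀ a, a ≠ b → X a = 0 → Y a = 0 := by
        intro c hcb hc
        have := hVX c hc
        rwa [Function.update_of_ne hcb] at this
      rw [Function.update_of_ne hab] at hVa
      refine ⟨Y, hY, fun hYb => ?_, hYX⟩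
      rcases M.eq_or_eq_neg hY hX (fun c hc => by
        by_cases hcb : c = b
        · rw [hcb, hYb]
        · exact hYX c hcb hc) with rfl | rfl
      · exact hXa hVa
      · exact hXa (h0 _ hVa)
    · refine absurd (funext fun c => ?_) hV0
      by_cases hcb : c = b
      · rw [hcb]; exact hVX b hXb
      · exact hV c hcb
  obtain ⟨Y, hY, hYb, hYX⟩ := hex
  obtain ⟨W, hW, -, hWb, hWX⟩ := exists_conformal_through hX hXb (fun _ => True)
    ⟨Y, hY, trivial, hYb, hYX⟩ (fun _ _ _ _ _ _ _ _ _ _ _ _ _ => trivial)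
  by_cases hWg : W g = 0
  swap
  · exact hdone W hW hWb hWg hWX
  obtain ⟨h, hhb, hWh⟩ := hb W hW
  have hWXh : W h = X h := (hWX h hhb).resolve_left hWh
  have hXh : X h ≠ 0 := hWXh ▸ hWh
  have hXW : ∀ a, a ≠ b → X a = 0 → W a = 0 := fun a hab ha => by
    rcases hWX a hab with h | h
    · exact h
    · rw [h, ha]
  have hXne : X ≠ - -W := by
    rw [neg_neg]
    rintro rfl
    exact hWb hXb
  -- circuits in `X ∪ b` through `b` that differ from `± W` contain `X \ W`
  have hcov : ∀ Z ∈ M.circuits, Z b ≠ 0 → (∀ a, a ≠ b → X a = 0 → Z a = 0) →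
      (∃ k, W k ≠ 0 ∧ Z k = 0) → ∀ g, X g ≠ 0 → W g = 0 → Z g ≠ 0 := by
    rintro Z hZ hZb hZX ⟨k, hWk, hZk⟩ g hg hWg hZg
    -- If `W` and `Z` had opposite signs at `b`, eliminating `b` would give a circuit inside `X`
    -- that misses `g`. Replacing `Z` by `-Z` covers equal signs.
    have key : ∀ Z ∈ M.circuits, (∀ a, a ≠ b → X a = 0 → Z a = 0) → Z k = 0 → Z g = 0 →
        W b ≠ -Z b := by
      intro Z hZ hZX hZk hZg hWZ
      have hne : W ≠ -Z := by
        intro h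
        apply hWk
        rw [h, Pi.neg_apply, hZk]; rfl
      obtain ⟨U, hU, hUb, hUWZ⟩ := M.exists_eliminate hW hZ hne hWb hWZ
      have hUg : U g = 0 := by
        rcases hUWZ g with h | h | h
        · exact h
        · rw [h, hWg]
        · rw [h, hZg]
      have hUX : ∀ c, X c = 0 → U c = 0 := by
        intro c hc
        by_cases hcb : c = b
        · rw [hcb, hUb]
        · rcases hUWZ c with h | h | h
          · exact h
          · rw [h, hXW c hcb hc]
          · rw [h, hZX c hcb hc]
      rcases M.eq_or_eq_neg hU hX hUX with rfl | rfl
      · exact hg hUg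
      · exact hg (h0 _ hUg)
    rcases signType_eq_or_eq_neg hWb hZb with h | h
    · refine key (-Z) (M.neg_mem hZ) ?_ ?_ ?_ ?_
      · intro a hab ha
        rw [Pi.neg_apply, hZX a hab ha]; rfl
      · rw [Pi.neg_apply, hZk]; rfl
      · rw [Pi.neg_apply, hZg]; rfl
      · rw [h, Pi.neg_apply, neg_neg]
    · exact key Z hZ hZX hZk hZg h
  obtain ⟨Z, hZ, hZh, hZXW⟩ := M.exists_eliminate hX (M.neg_mem hW) hXne hXh
    (by rw [Pi.neg_apply, neg_neg, hWXh])
  have hZX : ∀ a, a ≠ b → X a = 0 → Z a = 0 := by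
    intro a hab ha
    rcases hZXW a with h | h | h
    · exact h
    · rw [h, ha]
    · rw [h, Pi.neg_apply, hXW a hab ha]; rfl
  have hZb : Z b ≠ 0 := by
    intro hZb
    rcases M.eq_or_eq_neg hZ hX (fun c hc => by
        by_cases hcb : c = b
        · rw [hcb, hZb]
        · exact hZX c hcb hc) with rfl | rfl
    · exact hXh hZh
    · exact hXh (h0 _ hZh)
  have hZW : ∀ a, X a ≠ 0 → W a = 0 → Z a = X a := by
    intro a hXa hWa
    have := hcov Z hZ hZb hZX ⟨h, hWh, hZh⟩ a hXa hWa
    rcases hZXW a with h | h | h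
    · exact absurd h this
    · exact h
    · rw [Pi.neg_apply, hWa] at h
      exact absurd h this
  -- Agreement with `X` on `X \ W` survives elimination: a disagreement `k` lies in `W`, so `hcov`
  -- applies to the result, whose signs on `X \ W` can only be those of `X`.
  have hstep : ∀ Y ∈ M.circuits, (∀ a, X a ≠ 0 → W a = 0 → Y a = X a) → Y b ≠ 0 →
      (∀ a, a ≠ b → X a = 0 → Y a = 0) → ∀ k, X k ≠ 0 → Y k = -X k → ∀ Z ∈ M.circuits,
      Z b ≠ 0 → Z k = 0 → (∀ a, Z a = 0 ∨ Z a = X a ∨ Z a = Y a) →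
      ∀ a, X a ≠ 0 → W a = 0 → Z a = X a := by
    intro Y hY hPY hYb hYX k hXk hYk U hU hUb hUk hUXY a hXa hWa
    have hWk : W k ≠ 0 := fun hWk => hXk (h2 _ ((hPY k hXk hWk).symm.trans hYk))
    have hUX : ∀ a, a ≠ b → X a = 0 → U a = 0 := by
      intro a hab ha
      rcases hUXY a with h | h | h
      · exact h
      · rw [h, ha]
      · rw [h, hYX a hab ha]
    have := hcov U hU hUb hUX ⟨k, hWk, hUk⟩ a hXa hWa
    rcases hUXY a with h | h | h
    · exact absurd h this
    · exact h
    · rw [h, hPY a hXa hWa]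
  obtain ⟨V, hV, hVW, hVb, hVX⟩ := exists_conformal_through hX hXb
    (fun U => ∀ a, X a ≠ 0 → W a = 0 → U a = X a) ⟨Z, hZ, hZW, hZb, hZX⟩ hstep
  exact hdone V hV hVb (hVW g hg hWg ▸ hg) hVX

end Contraction

end OrientedMatroid

theorem SignOrthogonal.mul_eq_zero {E : Type*} {X Y : E → SignType} (h : SignOrthogonal X Y)
    {a : E} (h0 : ∀ c, c ≠ a → X c = 0 ∨ Y c = 0) : X a * Y a = 0 := by
  have h1 : ∀ s t : SignType, s = 0 ∨ t = 0 → s * t = 0 := by decide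
  have h2 : ∀ s : SignType, s = -s → s = 0 := by decide
  have h3 : ∀ s : SignType, s = -0 → s = 0 := by decide
  rcases signOrthogonal_iff.1 h with h | ⟨c, d, hc, hcd⟩
  · exact h a
  · by_cases hca : c = a
    · subst hca
      by_cases hda : d = c
      · subst hda
        exact h2 _ hcd
      · rw [h1 _ _ (h0 d hda)] at hcd
        exact h3 _ hcd
    · exact absurd (h1 _ _ (h0 c hca)) hc

theorem signOrthogonal_of_mul_eq_neg_mul {E : Type*} {X Y : E → SignType} {a b : E}
    (h : X a * Y a = -(X b * Y b)) (h0 : ∀ c, c ≠ a → c ≠ b → X c = 0 ∨ Y c = 0) :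
    SignOrthogonal X Y := by
  have h1 : ∀ s t : SignType, s = 0 ∨ t = 0 → s * t = 0 := by decide
  have h3 : ∀ s : SignType, 0 = -s → s = 0 := by decide
  rw [signOrthogonal_iff]
  by_cases ha : X a * Y a = 0
  · left
    intro c
    by_cases hca : c = a
    · rw [hca, ha]
    · by_cases hcb : c = b
      · rw [ha] at h
        rw [hcb, h3 _ h]
      · exact h1 _ _ (h0 c hca hcb)
  · exact Or.inr ⟨a, b, ha, h⟩

/-! ### The contraction as an oriented matroid. -/

namespace OrientedMatroid

variable {E : Type*} [Finite E]

section Contraction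

variable {M : OrientedMatroid E} {b : E}

open Classical in
theorem neg_mem_contractionFamily {V : E → SignType} (hV : V ∈ M.contractionFamily b) :
    -V ∈ M.contractionFamily b := by
  have hneg : -V ≠ 0 := fun h => hV.1 (by rw [← neg_neg V, h, neg_zero])
  obtain ⟨-, ⟨X, hX, rfl⟩ | hV⟩ := hV
  · refine ⟨hneg, Or.inl ⟨-X, M.neg_mem hX, ?_⟩⟩
    ext a
    by_cases hab : a = b
    · subst hab
      simp
    · simp [Function.update_of_ne hab]
  · exact ⟨hneg, Or.inr fun a ha => by rw [Pi.neg_apply, hV a ha, neg_zero]⟩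

theorem neg_mem_contractionCircuits {V : E → SignType} (hV : V ∈ M.contractionCircuits b) :
    -V ∈ M.contractionCircuits b := by
  refine ⟨neg_mem_contractionFamily hV.1, fun W hW h a ha => ?_⟩
  rw [Pi.neg_apply, hV.2 W hW (fun c hc => h c (by rw [Pi.neg_apply, hc, neg_zero])) a ha,
    neg_zero]

theorem eq_or_eq_neg_of_contractionCircuits (hb : M.IsNonloop b) {V W : E → SignType}
    (hV : V ∈ M.contractionCircuits b) (hW : W ∈ M.contractionCircuits b)
    (hVW : ∀ a, W a = 0 → V a = 0) : V = W ∨ V = -W := by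
  classical
  have hWV := hW.2 V hV.1 hVW
  obtain ⟨⟨hV0, ⟨X, hX, rfl⟩ | hVb⟩, hVmin⟩ := hV
  · obtain ⟨⟨hW0, ⟨Y, hY, rfl⟩ | hWb⟩, -⟩ := hW
    · by_contra! hne
      obtain ⟨g, hg⟩ := Function.ne_iff.1 hne.1
      have hgb : g ≠ b := by
        rintro rfl
        simp at hg
      simp only [Function.update_of_ne hgb] at hg
      have hX0 : X g ≠ 0 := by
        intro h
        have := hWV g (by rwa [Function.update_of_ne hgb])
        rw [Function.update_of_ne hgb] at this
        exact hg (h.trans this.symm)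
      have hY0 : Y g ≠ 0 := by
        intro h
        have := hVW g (by rwa [Function.update_of_ne hgb])
        rw [Function.update_of_ne hgb] at this
        exact hg (this.trans h.symm)
      have hXY : X ≠ -Y := by
        rintro rfl
        apply hne.2
        ext a
        by_cases hab : a = b
        · subst hab
          simp
        · simp [Function.update_of_ne hab]
      -- Off `b`, `Z` lies in the common support and misses `g`, against minimality.
      obtain ⟨Z, hZ, hZg, hZXY⟩ :=
        M.exists_eliminate hX hY hXY hX0 ((signType_eq_or_eq_neg hX0 hY0).resolve_left hg)
      have := hVmin _ (update_mem_contractionFamily hb hZ) (fun a ha => ?_) g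
        (by rwa [Function.update_of_ne hgb])
      · rw [Function.update_of_ne hgb] at this
        exact hX0 this
      · by_cases hab : a = b
        · rw [hab, Function.update_self]
        · have hYa := hWV a ha
          rw [Function.update_of_ne hab] at ha hYa ⊢
          rcases hZXY a with h | h | h
          · exact h
          · rw [h, ha]
          · rw [h, hYa]
    · refine absurd (funext fun a => ?_) hV0
      by_cases hab : a = b
      · rw [hab]; exact Function.update_self ..
      · exact hVW a (hWb a hab)
  · have hW' : ∀ a, a ≠ b → W a = 0 := fun a ha => hWV a (hVb a ha)
    have hWb0 : W b ≠ 0 := fun h => hW.1.1 (funext fun a => by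
      by_cases hab : a = b
      · rw [hab]; exact h
      · exact hW' a hab)
    refine (signType_eq_or_eq_neg (fun h => hWb0 (hWV b h)) hWb0).imp (fun h => ?_) fun h => ?_
    · ext a
      by_cases hab : a = b
      · rw [hab, h]
      · rw [hVb a hab, hW' a hab]
    · ext a
      by_cases hab : a = b
      · rw [hab, h, Pi.neg_apply]
      · rw [hVb a hab, Pi.neg_apply, hW' a hab, neg_zero]

/-- Elimination is done on lifts to `M`. The result need not be minimal after deleting `b`, but it
contains a conformal circuit of the contraction. -/
theorem contractionCircuits_elimination (hb : M.IsNonloop b) {V W : E → SignType}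
    (hV : V ∈ M.contractionCircuits b) (hW : W ∈ M.contractionCircuits b) (hne : V ≠ -W)
    {g : E} (hVg : V g ≠ 0) (hVW : V g = -W g) :
    ∃ U ∈ M.contractionCircuits b, U g = 0 ∧ ∀ a, U a = 0 ∨ U a = V a ∨ U a = W a := by
  classical
  have h0 : ∀ s : SignType, -s ≠ 0 → s ≠ 0 := by decide
  have hWg : W g ≠ 0 := h0 _ (hVW ▸ hVg)
  -- Only the loop at `b` is non-zero at `b`, so `g = b` would force `V = -W`.
  have hgb : g ≠ b := by
    rintro rfl
    have hloop : ∀ {U : E → SignType}, U ∈ M.contractionCircuits g → U g ≠ 0 →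
        ∀ a, a ≠ g → U a = 0 := by
      rintro U ⟨⟨-, ⟨X, hX, rfl⟩ | h⟩, -⟩ hUg
      · exact absurd (Function.update_self ..) hUg
      · exact h
    apply hne
    ext a
    by_cases hag : a = g
    · rw [hag, hVW, Pi.neg_apply]
    · rw [hloop hV hVg a hag, Pi.neg_apply, hloop hW hWg a hag, neg_zero]
  obtain ⟨⟨-, ⟨X, hX, rfl⟩ | hVb⟩, -⟩ := hV
  swap
  · exact absurd (hVb g hgb) hVg
  obtain ⟨⟨-, ⟨Y, hY, rfl⟩ | hWb⟩, -⟩ := hW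
  swap
  · exact absurd (hWb g hgb) hWg
  rw [Function.update_of_ne hgb] at hVg hWg hVW
  rw [Function.update_of_ne hgb] at hVW
  have hXY : X ≠ -Y := by
    rintro rfl
    apply hne
    ext a
    by_cases hab : a = b
    · subst hab
      simp
    · simp [Function.update_of_ne hab]
  obtain ⟨Z, hZ, hZg, hZXY⟩ := M.exists_eliminate hX hY hXY hVg hVW
  obtain ⟨a, hab, ha⟩ := hb Z hZ
  obtain ⟨U, hU, hUa, hUZ⟩ := exists_contractionCircuit_conformal hb hZ hab ha
  have hU0 : ∀ c, Z c = 0 → U c = 0 := fun c hc => (hUZ c).elim id fun h => h.trans hc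
  refine ⟨U, hU, hU0 g hZg, fun c => ?_⟩
  by_cases hcb : c = b
  · left
    obtain ⟨⟨-, ⟨X, hX, rfl⟩ | hUb⟩, -⟩ := hU
    · rw [hcb, Function.update_self]
    · exact absurd (hUb a hab) hUa
  · simp only [Function.update_of_ne hcb]
    rcases hUZ c with h | h
    · exact Or.inl h
    · rw [h]
      exact hZXY c

/-- The contraction by a nonloop `b`, where `b` is kept as a loop. -/
def contraction (M : OrientedMatroid E) (b : E) (hb : M.IsNonloop b) : OrientedMatroid E where
  circuits := M.contractionCircuits b
  zero_notMem h := h.1.1 rfl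
  neg_mem_iff X := ⟨neg_mem_contractionCircuits, fun h => by
    rw [← neg_neg X]
    exact neg_mem_contractionCircuits h⟩
  incomparable X hX Y hY h :=
    eq_or_eq_neg_of_contractionCircuits hb hX hY (signSupport_subset_iff.1 h)
  elimination := by
    rintro X hX Y hY hne e ⟨he, he'⟩
    have h1 : X e = 1 := he
    have h2 : Y e = -1 := he'
    obtain ⟨Z, hZ, hZe, hZXY⟩ := contractionCircuits_elimination hb hX hY hne (g := e)
      (by rw [h1]; decide) (by rw [h1, h2]; decide)
    refine ⟨Z, hZ, fun a ha => ⟨?_, ?_⟩, fun a ha => ⟨?_, ?_⟩⟩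
    · have ha : Z a = 1 := ha
      rcases hZXY a with h | h | h
      · rw [ha] at h; exact absurd h (by decide)
      · exact Or.inl (h.symm.trans ha)
      · exact Or.inr (h.symm.trans ha)
    · rintro rfl
      have ha : Z a = 1 := ha
      rw [ha] at hZe; exact absurd hZe (by decide)
    · have ha : Z a = -1 := ha
      rcases hZXY a with h | h | h
      · rw [ha] at h; exact absurd h (by decide)
      · exact Or.inl (h.symm.trans ha)
      · exact Or.inr (h.symm.trans ha)
    · rintro rfl
      have ha : Z a = -1 := ha
      rw [ha] at hZe; exact absurd hZe (by decide)

theorem IsCovector.of_contraction {hb : M.IsNonloop b} {D : E → SignType}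
    (hD : (M.contraction b hb).IsCovector D) (hDb : D b = 0) : M.IsCovector D := by
  intro X hX
  refine signOrthogonal_of_conformal_cover fun g hg hDg => ?_
  obtain ⟨V, hV, hVg, hVX⟩ :=
    exists_contractionCircuit_conformal hb hX (by rintro rfl; exact hDg hDb) hg
  exact ⟨V, hD V hV, hVg, hVX⟩

end Contraction

/-! ### Orthogonality to fundamental circuits suffices. -/

/-- A circuit not of the form `{e, f}` or smaller contains some `f, g ≠ e`. Eliminating `e` between
circuits on `{e, f}` and `{e, g}` gives a circuit on `{f, g}`, which must be the given one up to
sign; the two product relations chain through `e`. -/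
theorem isCovector_of_rank_one {M : OrientedMatroid E} {e : E}
    (hind : M.IsNonloop e) (hspan : ∀ f, f ≠ e → ∃ X ∈ M.circuits, ∀ a, a ≠ e → a ≠ f → X a = 0)
    {D : E → SignType}
    (hD : ∀ X ∈ M.circuits, ∀ f, (∀ a, a ≠ e → a ≠ f → X a = 0) → SignOrthogonal X D) :
    M.IsCovector D := by
  have h0 : ∀ s : SignType, -s = 0 → s = 0 := by decide
  intro X hX
  obtain ⟨f, hfe, hf⟩ := hind X hX
  by_cases hg : ∀ a, a ≠ e → a ≠ f → X a = 0
  · exact hD X hX f hg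
  push Not at hg
  obtain ⟨g, hge, hgf, hg⟩ := hg
  have key : ∀ f, f ≠ e → X f ≠ 0 → (∃ g, g ≠ e ∧ g ≠ f ∧ X g ≠ 0) →
      ∃ C ∈ M.circuits, C e ≠ 0 ∧ C f ≠ 0 ∧ (∀ a, a ≠ e → a ≠ f → C a = 0) ∧
        C e * D e = -(C f * D f) := by
    rintro f hfe hf ⟨g, hge, hgf, hg⟩
    obtain ⟨C, hC, hC0⟩ := hspan f hfe
    refine ⟨C, hC, fun hCe => ?_, fun hCf => ?_, hC0,
      (hD C hC f hC0).mul_eq_neg_mul hfe.symm fun c h1 h2 => Or.inl (hC0 c h1 h2)⟩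
    · rcases M.eq_or_eq_neg hC hX (fun a ha => by
        by_cases hae : a = e
        · rw [hae, hCe]
        · exact hC0 a hae (by rintro rfl; exact hf ha)) with rfl | rfl
      · exact hg (hC0 g hge hgf)
      · exact hg (h0 _ (hC0 g hge hgf))
    · obtain ⟨a, hae, ha⟩ := hind C hC
      by_cases haf : a = f
      · exact ha (haf ▸ hCf)
      · exact ha (hC0 a hae haf)
  obtain ⟨C, hC, hCe, hCf, hC0, hCD⟩ := key f hfe hf ⟨g, hge, hgf, hg⟩
  have : ∃ C' ∈ M.circuits, C e = -C' e ∧ C' g ≠ 0 ∧ (∀ a, a ≠ e → a ≠ g → C' a = 0) ∧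
      C' e * D e = -(C' g * D g) := by
    obtain ⟨C', hC', hCe', hCg', hC0', hCD'⟩ := key g hge hg ⟨f, hfe, hgf.symm, hf⟩
    rcases signType_eq_or_eq_neg hCe hCe' with h | h
    · refine ⟨-C', M.neg_mem hC', by rw [h, Pi.neg_apply, neg_neg], fun h => hCg' (h0 _ h),
        fun a h1 h2 => by rw [Pi.neg_apply, hC0' a h1 h2, neg_zero], ?_⟩
      rw [Pi.neg_apply, Pi.neg_apply, neg_mul, neg_mul, hCD']
    · exact ⟨C', hC', h, hCg', hC0', hCD'⟩
  obtain ⟨C', hC', hCe', hCg', hC0', hCD'⟩ := this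
  have hne : C ≠ -C' := by
    rintro rfl
    exact hCg' (h0 _ (hC0 g hge hgf))
  obtain ⟨Z, hZ, hZe, hZC⟩ := M.exists_eliminate hC hC' hne hCe hCe'
  have hZ0 : ∀ a, a ≠ f → a ≠ g → Z a = 0 := by
    intro a haf hag
    by_cases hae : a = e
    · rw [hae, hZe]
    · rcases hZC a with h | h | h
      · exact h
      · rw [h, hC0 a hae haf]
      · rw [h, hC0' a hae hag]
  have hXZ : X = Z ∨ X = -Z := by
    rcases M.eq_or_eq_neg hZ hX (fun a ha => hZ0 a (by rintro rfl; exact hf ha)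
      (by rintro rfl; exact hg ha)) with h | h
    · exact Or.inl h.symm
    · exact Or.inr (by rw [h, neg_neg])
  have hZf : Z f ≠ 0 := by
    rcases hXZ with rfl | rfl
    · exact hf
    · exact fun h => hf (by rw [Pi.neg_apply, h, neg_zero])
  have hZg : Z g ≠ 0 := by
    rcases hXZ with rfl | rfl
    · exact hg
    · exact fun h => hg (by rw [Pi.neg_apply, h, neg_zero])
  have hZf' : Z f = C f := by
    rcases hZC f with h | h | h
    · exact absurd h hZf
    · exact h
    · exact absurd (h.trans (hC0' f hfe hgf.symm)) hZf
  have hZg' : Z g = C' g := by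
    rcases hZC g with h | h | h
    · exact absurd h hZg
    · exact absurd (h.trans (hC0 g hge hgf)) hZg
    · exact h
  have hZD : SignOrthogonal Z D := by
    refine signOrthogonal_of_mul_eq_neg_mul (a := f) (b := g) ?_ fun c h1 h2 => Or.inl (hZ0 c h1 h2)
    rw [hZf', hZg', ← hCD', ← neg_neg (C f * D f), ← hCD, hCe', neg_mul, neg_neg]
  rcases hXZ with rfl | rfl
  · exact hZD
  · exact hZD.neg_left

/-- A sign vector that vanishes on all but one element of a basis and is orthogonal to all
fundamental circuits is a covector. -/
theorem isCovector_of_orthogonal_fundamental (k : ℕ) : ∀ (M : OrientedMatroid E) (B : Set E),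
    B.ncard = k → (∀ X ∈ M.circuits, ∃ a, a ∉ B ∧ X a ≠ 0) →
    (∀ f, f ∉ B → ∃ X ∈ M.circuits, ∀ a, a ∉ B → a ≠ f → X a = 0) →
    ∀ e ∈ B, ∀ D : E → SignType, (∀ a ∈ B, a ≠ e → D a = 0) →
    (∀ X ∈ M.circuits, ∀ f, (∀ a, a ∉ B → a ≠ f → X a = 0) → SignOrthogonal X D) →
    M.IsCovector D := by
  classical
  induction k with
  | zero =>
    intro M B hB _ _ e he
    rw [Set.ncard_eq_zero (Set.toFinite B)] at hB
    rw [hB] at he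
    exact absurd he (Set.notMem_empty e)
  | succ k ih =>
    intro M B hB hind hspan e he D hD0 hD
    by_cases hex : ∃ b ∈ B, b ≠ e
    · obtain ⟨b, hbB, hbe⟩ := hex
      have hb : M.IsNonloop b := fun X hX => by
        obtain ⟨a, haB, ha⟩ := hind X hX
        exact ⟨a, fun h => haB (h ▸ hbB), ha⟩
      refine IsCovector.of_contraction (hb := hb) (ih (M.contraction b hb) (B \ {b}) ?_ ?_ ?_ e
        ⟨he, fun h => hbe h.symm⟩ D (fun a ha => hD0 a ha.1) ?_) (hD0 b hbB hbe)
      · rw [Set.ncard_sdiff_singleton_of_mem hbB, hB, Nat.add_sub_cancel]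
      · rintro V ⟨⟨hV0, ⟨X, hX, rfl⟩ | hV⟩, -⟩
        · obtain ⟨a, haB, ha⟩ := hind X hX
          refine ⟨a, fun h => haB h.1, ?_⟩
          rwa [Function.update_of_ne (ne_of_mem_of_not_mem hbB haB).symm]
        · obtain ⟨a, ha⟩ := Function.ne_iff.1 hV0
          exact ⟨a, fun h => ha (hV a h.2), ha⟩
      · intro f hf
        -- After contraction `b` lies outside the basis; its fundamental circuit is the loop at `b`.
        by_cases hfb : f = b
        · subst hfb
          refine ⟨Function.update 0 f 1, ⟨⟨fun h => ?_, Or.inr fun a ha => ?_⟩,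
            fun V hV hVf a ha => ?_⟩, fun a _ ha => ?_⟩
          · have := congrFun h f
            rw [Function.update_self] at this
            exact one_ne_zero this
          · rw [Function.update_of_ne ha]; rfl
          · by_cases haf : a = f
            · subst haf
              refine absurd (funext fun c => ?_) hV.1
              by_cases hc : c = a
              · rw [hc]; exact ha
              · exact hVf c (by rw [Function.update_of_ne hc]; rfl)
            · rw [Function.update_of_ne haf]; rfl
          · rw [Function.update_of_ne ha]; rfl
        · obtain ⟨X, hX, hXf⟩ := hspan f fun h => hf ⟨h, hfb⟩
          obtain ⟨g, hgb, hg⟩ := hb X hX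
          obtain ⟨V, hV, hVg, hVX⟩ := exists_contractionCircuit_conformal hb hX hgb hg
          refine ⟨V, hV, fun a haB haf => ?_⟩
          by_cases hab : a = b
          · obtain ⟨⟨-, ⟨Y, hY, rfl⟩ | hVb⟩, -⟩ := hV
            · rw [hab, Function.update_self]
            · exact absurd (hVb g hgb) hVg
          · exact (hVX a).elim id fun h => h.trans (hXf a (fun h => haB ⟨h, hab⟩) haf)
      · rintro V ⟨⟨-, ⟨X, hX, rfl⟩ | hVb⟩, -⟩ f hf
        · have hDb := hD0 b hbB hbe
          refine (hD X hX f fun a haB haf => ?_).of_eq_mul fun a => ?_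
          · have := hf a (fun h => haB h.1) haf
            rwa [Function.update_of_ne (ne_of_mem_of_not_mem hbB haB).symm] at this
          · by_cases hab : a = b
            · rw [hab, hDb, mul_zero, mul_zero]
            · rw [Function.update_of_ne hab]
        · refine signOrthogonal_iff.2 (Or.inl fun a => ?_)
          by_cases hab : a = b
          · rw [hab, hD0 b hbB hbe, mul_zero]
          · rw [hVb a hab, zero_mul]
    · push Not at hex
      have hBe : ∀ a, a ∉ B ↔ a ≠ e := fun a =>
        ⟨fun h h' => h (h' ▸ he), fun h h' => h (hex a h')⟩
      simp only [hBe] at hind hspan hD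
      exact isCovector_of_rank_one hind hspan hD

/-! ### Bases, fundamental circuits and fundamental cocircuits. -/

theorem IsBasis.exists_notMem {M : OrientedMatroid E} {B : Set E} (hB : M.IsBasis B)
    {X : E → SignType} (hX : X ∈ M.circuits) : ∃ a, a ∉ B ∧ X a ≠ 0 := by
  obtain ⟨a, ha, haB⟩ := Set.not_subset.1 (hB.prop X hX)
  exact ⟨a, haB, mem_signSupport.1 ha⟩

theorem isFundamentalCircuit_iff {M : OrientedMatroid E} {B : Set E} {f : E} {X : E → SignType} :
    M.IsFundamentalCircuit B f X ↔
      X ∈ M.circuits ∧ X f = 1 ∧ ∀ a, a ∉ B → a ≠ f → X a = 0 := by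
  refine and_congr_right fun _ => and_congr_right fun _ => ?_
  simp only [Set.subset_def, mem_signSupport, Set.union_singleton, Set.mem_insert_iff]
  exact forall_congr' fun a => by tauto

theorem IsBasis.exists_isFundamentalCircuit {M : OrientedMatroid E} {B : Set E}
    (hB : M.IsBasis B) {f : E} (hf : f ∉ B) : ∃ X, M.IsFundamentalCircuit B f X := by
  simp only [isFundamentalCircuit_iff]
  have : ∃ X ∈ M.circuits, signSupport X ⊆ insert f B := by
    by_contra! h
    exact hf (hB.le_of_ge (y := insert f B) h (Set.subset_insert f B) (Set.mem_insert f B))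
  obtain ⟨X, hX, hXB⟩ := this
  have hX0 : ∀ a, a ∉ B → a ≠ f → X a = 0 := by
    intro a haB haf
    by_contra ha
    exact (hXB (mem_signSupport.2 ha)).elim haf haB
  obtain ⟨a, haB, ha⟩ := hB.exists_notMem hX
  have haf : a = f := by
    by_contra haf
    exact ha (hX0 a haB haf)
  subst haf
  rcases signType_eq_or_eq_neg ha (t := 1) (by decide) with h | h
  · exact ⟨X, hX, h, hX0⟩
  · exact ⟨-X, M.neg_mem hX, by rw [Pi.neg_apply, h, neg_neg],
      fun c h1 h2 => by rw [Pi.neg_apply, hX0 c h1 h2, neg_zero]⟩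

theorem IsBasis.isFundamentalCircuit_unique {M : OrientedMatroid E} {B : Set E}
    (hB : M.IsBasis B) {f : E} {X Y : E → SignType} (hX : M.IsFundamentalCircuit B f X)
    (hY : M.IsFundamentalCircuit B f Y) : X = Y := by
  rw [isFundamentalCircuit_iff] at hX hY
  obtain ⟨hX, hXf, hX0⟩ := hX
  obtain ⟨hY, hYf, hY0⟩ := hY
  by_contra hne
  obtain ⟨Z, hZ, hZf, hZXY⟩ := M.exists_eliminate hX (M.neg_mem hY) (by rwa [neg_neg]) (g := f)
    (by rw [hXf]; decide) (by rw [hXf, Pi.neg_apply, hYf, neg_neg])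
  obtain ⟨a, haB, ha⟩ := hB.exists_notMem hZ
  have haf : a ≠ f := by rintro rfl; exact ha hZf
  rcases hZXY a with h | h | h
  · exact ha h
  · exact ha (h.trans (hX0 a haB haf))
  · exact ha (by rw [h, Pi.neg_apply, hY0 a haB haf, neg_zero])

/-- For `a ∉ B`, the fundamental circuit of `a` can meet `Y` only in `a`, and orthogonality forbids
a one-element intersection. -/
theorem IsBasis.eq_zero_of_isCovector {M : OrientedMatroid E} {B : Set E} (hB : M.IsBasis B)
    {Y : E → SignType} (hY : M.IsCovector Y) (h0 : ∀ a ∈ B, Y a = 0) : Y = 0 := by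
  ext a
  by_cases haB : a ∈ B
  · exact h0 a haB
  obtain ⟨X, hX⟩ := hB.exists_isFundamentalCircuit haB
  obtain ⟨hX, hXa, hX0⟩ := isFundamentalCircuit_iff.1 hX
  have := (hY X hX).mul_eq_zero (a := a) fun c hc => by
    by_cases hcB : c ∈ B
    · exact Or.inr (h0 c hcB)
    · exact Or.inl (hX0 c hcB hc)
  rwa [hXa, one_mul] at this

/-- A covector vanishing on `B \ {e}` is determined by its sign at `e`. -/
theorem IsBasis.isCovector_eq_mul {M : OrientedMatroid E} {B : Set E} (hB : M.IsBasis B) {e : E}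
    (he : e ∈ B) {D Y : E → SignType} (hD : M.IsCovector D) (hDe : D e = 1)
    (hD0 : ∀ a ∈ B, a ≠ e → D a = 0) (hY : M.IsCovector Y) (hY0 : ∀ a ∈ B, a ≠ e → Y a = 0)
    (a : E) : Y a = Y e * D a := by
  by_cases haB : a ∈ B
  · by_cases hae : a = e
    · rw [hae, hDe, mul_one]
    · rw [hD0 a haB hae, hY0 a haB hae, mul_zero]
  obtain ⟨X, hX⟩ := hB.exists_isFundamentalCircuit haB
  obtain ⟨hX, hXa, hX0⟩ := isFundamentalCircuit_iff.1 hX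
  have key : ∀ Z : E → SignType, M.IsCovector Z → (∀ a ∈ B, a ≠ e → Z a = 0) →
      X e * Z e = -(X a * Z a) := fun Z hZ hZ0 =>
    (hZ X hX).mul_eq_neg_mul (by rintro rfl; exact haB he) fun c hce hca => by
      by_cases hcB : c ∈ B
      · exact Or.inr (hZ0 c hcB hce)
      · exact Or.inl (hX0 c hcB hca)
  have h1 := key D hD hD0
  have h2 := key Y hY hY0
  rw [hXa, one_mul] at h1 h2
  rw [hDe, mul_one] at h1
  have h3 : ∀ x y d z : SignType, x = -d → x * y = -z → z = y * d := by decide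
  exact h3 _ _ _ _ h1 h2

theorem isFundamentalCocircuit_iff {M : OrientedMatroid E} {B : Set E} {e : E}
    {D : E → SignType} : M.IsFundamentalCocircuit B e D ↔
      D ∈ M.cocircuits ∧ D e = 1 ∧ ∀ a ∈ B, a ≠ e → D a = 0 := by
  refine and_congr_right fun _ => and_congr_right fun _ => ?_
  simp only [Set.eq_empty_iff_forall_notMem, Set.mem_inter_iff, mem_signSupport, Set.mem_sdiff,
    Set.mem_singleton_iff]
  exact forall_congr' fun a => by tauto

theorem IsBasis.exists_isCovector {M : OrientedMatroid E} {B : Set E} (hB : M.IsBasis B) {e : E}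
    (he : e ∈ B) : ∃ D, M.IsCovector D ∧ D e = 1 ∧ ∀ a ∈ B, a ≠ e → D a = 0 := by
  classical
  choose C hC using fun f : {f // f ∉ B} => hB.exists_isFundamentalCircuit f.2
  -- The signs off `B` are forced by orthogonality to the fundamental circuits.
  let D : E → SignType := fun a => if h : a ∉ B then -C ⟨a, h⟩ e else if a = e then 1 else 0
  have hDe : D e = 1 := by simp [D, he]
  have hD0 : ∀ a ∈ B, a ≠ e → D a = 0 := fun a ha hae => by simp [D, ha, hae]
  have hDf : ∀ a (h : a ∉ B), D a = -C ⟨a, h⟩ e := fun a h => by simp [D, h]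
  refine ⟨D, isCovector_of_orthogonal_fundamental _ M B rfl (fun X => hB.exists_notMem)
    (fun f hf => ⟨_, (isFundamentalCircuit_iff.1 (hC ⟨f, hf⟩)).1,
      (isFundamentalCircuit_iff.1 (hC ⟨f, hf⟩)).2.2⟩) e he D hD0 ?_, hDe, hD0⟩
  intro X hX f hXf
  obtain ⟨a, haB, ha⟩ := hB.exists_notMem hX
  have haf : a = f := by
    by_contra haf
    exact ha (hXf a haB haf)
  subst haf
  have key : ∀ X, M.IsFundamentalCircuit B a X → SignOrthogonal X D := by
    intro X hX
    obtain rfl := hB.isFundamentalCircuit_unique hX (hC ⟨a, haB⟩)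
    obtain ⟨-, hXa, hX0⟩ := isFundamentalCircuit_iff.1 hX
    refine signOrthogonal_of_mul_eq_neg_mul (a := e) (b := a) ?_ fun c hce hca => ?_
    · rw [hDe, hXa, hDf a haB, one_mul, neg_neg, mul_one]
    · by_cases hcB : c ∈ B
      · exact Or.inr (hD0 c hcB hce)
      · exact Or.inl (hX0 c hcB hca)
  rcases signType_eq_or_eq_neg ha (t := 1) (by decide) with h | h
  · exact key X (isFundamentalCircuit_iff.2 ⟨hX, h, hXf⟩)
  · rw [← neg_neg X]
    exact (key (-X) (isFundamentalCircuit_iff.2 ⟨M.neg_mem hX, by rw [Pi.neg_apply, h, neg_neg],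
      fun c h1 h2 => by rw [Pi.neg_apply, hXf c h1 h2, neg_zero]⟩)).neg_left

theorem IsBasis.existsUnique_isFundamentalCocircuit {M : OrientedMatroid E} {B : Set E}
    (hB : M.IsBasis B) {e : E} (he : e ∈ B) : ∃! D, M.IsFundamentalCocircuit B e D := by
  simp only [isFundamentalCocircuit_iff]
  obtain ⟨D, hD, hDe, hD0⟩ := hB.exists_isCovector he
  refine ⟨D, ⟨⟨hD, fun h => ?_, fun Z hZ hZ0 hZD => ?_⟩, hDe, hD0⟩, fun Y ⟨hY, hYe, hY0⟩ => ?_⟩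
  · rw [h] at hDe
    exact zero_ne_one hDe
  · have hZD' := signSupport_subset_iff.1 hZD
    -- A covector supported inside `D` is `Z e` times `D`, so the support of `D` is minimal.
    have hZ' := hB.isCovector_eq_mul he hD hDe hD0 hZ fun a ha hae => hZD' a (hD0 a ha hae)
    refine hZD.antisymm (signSupport_subset_iff.2 fun a ha => ?_)
    have hZe : Z e ≠ 0 := fun h => hZ0 (funext fun a => by rw [hZ' a, h, zero_mul]; rfl)
    rw [hZ' a, mul_eq_zero] at ha
    exact ha.resolve_left hZe
  · ext a
    rw [hB.isCovector_eq_mul he hD hDe hD0 hY.1 hY0 a, hYe, one_mul]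

theorem exists_isBasis_superset {M : OrientedMatroid E} {I : Set E}
    (hI : ∀ X ∈ M.circuits, ¬ signSupport X ⊆ I) : ∃ B, I ⊆ B ∧ M.IsBasis B :=
  Finite.exists_le_maximal hI

/-! ### Bases and signs in the extension. -/

section Extension

variable {M : OrientedMatroid E} {σ : M.cocircuits → SignType} {Mhat : OrientedMatroid (Option E)}

theorem IsExtensionSpecifiedBy.isCovector (h : M.IsExtensionSpecifiedBy σ Mhat)
    (Y : M.cocircuits) : Mhat.IsCovector (extendSign Y.1 (σ Y)) := by
  have : extendSign Y.1 (σ Y) ∈ Mhat.cocircuits := by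
    rw [h]
    exact Or.inl ⟨Y, rfl⟩
  exact this.1

/-- A basis of `M` is a basis of each extension of `M`. -/
theorem IsExtensionSpecifiedBy.isBasis (h : M.IsExtensionSpecifiedBy σ Mhat) {B : Set E}
    (hB : M.IsBasis B) : Mhat.IsBasis (some '' B) := by
  refine ⟨fun X hX hXB => ?_, fun I hI hBI o hoI => ?_⟩
  · rw [Set.subset_def] at hXB
    simp only [mem_signSupport] at hXB
    obtain ⟨o, ho⟩ := Mhat.exists_apply_ne_zero hX
    obtain ⟨e, he, rfl⟩ := hXB o ho
    obtain ⟨D, hD, -⟩ := hB.existsUnique_isFundamentalCocircuit he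
    obtain ⟨hD, hDe, hD0⟩ := isFundamentalCocircuit_iff.1 hD
    have := (h.isCovector ⟨D, hD⟩ X hX).mul_eq_zero (a := some e) fun c hc => by
      by_cases hXc : X c = 0
      · exact Or.inl hXc
      · obtain ⟨a, ha, rfl⟩ := hXB c hXc
        exact Or.inr (hD0 a ha fun h => hc (h ▸ rfl))
    rw [show extendSign D (σ ⟨D, hD⟩) (some e) = 1 from hDe, mul_one] at this
    exact ho this
  · by_contra hoB
    -- The fundamental cocircuit of `o` for a basis containing `I` vanishes on `B`. In either form
    -- of a cocircuit of the extension, its first constituent `Y` then vanishes on `B` too, so `Y =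
    -- 0`.
    obtain ⟨B', hIB', hB'⟩ := exists_isBasis_superset hI
    obtain ⟨D, hD, -⟩ := hB'.existsUnique_isFundamentalCocircuit (hIB' hoI)
    obtain ⟨hD, -, hD0⟩ := isFundamentalCocircuit_iff.1 hD
    have hDB : ∀ a ∈ B, D (some a) = 0 := fun a ha =>
      hD0 _ (hIB' (hBI ⟨a, ha, rfl⟩)) fun h => hoB (h ▸ ⟨a, ha, rfl⟩)
    rw [h] at hD
    rcases hD with ⟨Y, rfl⟩ | ⟨Y, Y', -, -, -, rfl⟩
    · exact Y.2.2.1 (hB.eq_zero_of_isCovector Y.2.1 hDB)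
    · refine Y.2.2.1 (hB.eq_zero_of_isCovector Y.2.1 fun a ha => ?_)
      by_contra hYa
      have hc : (if Y.1 a = 0 then Y'.1 a else Y.1 a) = 0 := hDB a ha
      rw [if_neg hYa] at hc
      exact hYa hc

/-- `C` lives on `B ∪ {q}` and `D` vanishes on `B \ {e}`, so only `e` and `q` contribute to the
orthogonality of `C` and `(D, σ D)`. The case `σ D = 0` is included: then `C e = 0`. -/
theorem IsExtensionSpecifiedBy.fundamentalCircuit_apply (h : M.IsExtensionSpecifiedBy σ Mhat)
    {B : Set E} {e : E} {C : Option E → SignType} {D : E → SignType}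
    (hC : Mhat.IsFundamentalCircuit (some '' B) none C) (hD : M.IsFundamentalCocircuit B e D) :
    C (some e) = -σ ⟨D, hD.1⟩ := by
  obtain ⟨hC, hCq, hC0⟩ := isFundamentalCircuit_iff.1 hC
  obtain ⟨-, hDe, hD0⟩ := isFundamentalCocircuit_iff.1 hD
  have := (h.isCovector ⟨D, hD.1⟩ C hC).mul_eq_neg_mul (a := some e) (b := none)
    (Option.some_ne_none e) fun c hce hcq => by
      obtain ⟨a, rfl⟩ := Option.ne_none_iff_exists'.1 hcq
      by_cases haB : a ∈ B
      · exact Or.inr (hD0 a haB fun h => hce (h ▸ rfl))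
      · refine Or.inl (hC0 _ ?_ hcq)
        rintro ⟨a', ha', h⟩
        exact haB (Option.some.inj h ▸ ha')
  rwa [hCq, one_mul, show extendSign D (σ ⟨D, hD.1⟩) (some e) = 1 from hDe, mul_one] at this

end Extension

end OrientedMatroid

theorem mainTheorem10 (n : ℕ) (M : OrientedMatroid (Fin n ⊕ Fin n)) (hM : M.IsPMatroid)
    (σ : M.cocircuits → SignType) (hσ : M.IsLocalization σ)
    (Mhat : OrientedMatroid (Option (Fin n ⊕ Fin n))) (hMhat : M.IsExtensionSpecifiedBy σ Mhat)
    (B : Set (Fin n ⊕ Fin n)) (hB : M.IsBasis B) (hBc : OrientedMatroid.IsComplementary B) :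
    Mhat.IsBasis (some '' B) ∧
    (∃! C, Mhat.IsFundamentalCircuit (some '' B) none C) ∧
    ∀ e ∈ B,
      (∃! D, M.IsFundamentalCocircuit B e D) ∧
      ∀ C D, Mhat.IsFundamentalCircuit (some '' B) none C →
        ∀ hD : M.IsFundamentalCocircuit B e D, C (some e) = -σ ⟨D, hD.1⟩ := by
  have hB' := hMhat.isBasis hB
  obtain ⟨C, hC⟩ := hB'.exists_isFundamentalCircuit (f := none) (by simp)
  exact ⟨hB', ⟨C, hC, fun C' hC' => hB'.isFundamentalCircuit_unique hC' hC⟩, fun e he =>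
    ⟨hB.existsUnique_isFundamentalCocircuit he,
      fun C D hC hD => hMhat.fundamentalCircuit_apply hC hD⟩⟩
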